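/- All graphs are finite and simple. A graph $G$ contains a graph $H$ as an immersion if there are an injective map $\varphi : V(H) \to V(G)$ and, for every edge $uv \in E(H)$, a path $P_{uv}$ in $G$ joining $\varphi(u)$ and $\varphi(v)$, such that the paths $P_{uv}$ $(uv \in E(H))$ are pairwise edge-disjoint. Let $G$ be a graph on $n$ vertices whose independence number (the largest size of a set of pairwise non-adjacent vertices) is $\alpha(G) = 2$, and let $\ell$ be a positive integer with $2\ell \le \lceil n/2 \rceil$. Then $G$ contains the complete bipartite graph $K_{\ell,\, \lceil n/2 \rceil - \ell}$ as an immersion. -/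

import Mathlib

/-- `G` contains `H` as an immersion: there are an injection `φ` of the vertices of `H` into
those of `G`, and for every edge `uv` of `H` a path of `G` from `φ u` to `φ v`, such that the paths
of different edges of `H` have no edge in common.

The paths are indexed by the darts (oriented edges) of `H`, so that their end points can be named.
The two orientations of one edge are not compared with each other, so this amounts to choosing one
path for each edge. -/
def SimpleGraph.ContainsImmersion {V W : Type*} (G : SimpleGraph V) (H : SimpleGraph W) : Prop :=
  ∃ (φ : W ↪ V) (P : (d : H.Dart) → G.Path (φ d.fst) (φ d.snd)),
    ∀ d d' : H.Dart, d.edge ≠ d'.edge →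
      List.Disjoint (P d).val.edges (P d').val.edges

open Finset

/-! Let `H` be the complement of `G`; it is triangle-free because `α(G) = 2`. By induction on `m`,
every set `S` of `2m - 1` vertices carries an immersed `K_{l,m-l}` whenever `2l ≤ m`. Given an edge
`uv` of `H`, delete `u` and `v`, take the smaller biclique, and add `u` to one side. An `a` on the
other side that is not joined to `u` in `G` is reached by `a, v, g a, u`, where `g a` lies outside
both `H`-neighbourhoods; there is room for `g` when `d(u) + d(v) + l ≤ |S|`
(`HasBicliqueIn.succ_right_of_edge`). An isolated vertex of `H` is added directly. Otherwise `d(u) +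
d(v) ≥ 2m - l` for every edge of `H`. Either `m` vertices are independent in `H`, hence a clique of
`G`, or `H` contains a five-cycle and is homomorphic to it (`exists_hom_five_cycle`). In the latter
case the biclique lives on three consecutive colour classes, and its missing pairs are routed
through the other two by Latin rectangles (`hasBicliqueIn_of_hom_five_cycle`). -/

/-! ### Immersed bicliques and paths of length two -/

/-- The graph `Hᶜ` contains, inside the vertex set `S`, disjoint branch sets `A` and `B` and pairwise
disjoint sets `E x y` of edges, each carrying a walk between `x ∈ A` and `y ∈ B`. -/
structure IsBicliqueIn {V : Type*} (H : SimpleGraph V) (S A B : Finset V)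
    (E : V → V → Set (Sym2 V)) : Prop where
  left_subset : A ⊆ S
  right_subset : B ⊆ S
  disj : Disjoint A B
  walk : ∀ x ∈ A, ∀ y ∈ B, ∃ w : Hᶜ.Walk x y, ∀ e ∈ w.edges, e ∈ E x y
  support : ∀ x ∈ A, ∀ y ∈ B, ∀ e ∈ E x y, ∀ z ∈ e, z ∈ S
  edge_disj : ∀ x ∈ A, ∀ y ∈ B, ∀ x' ∈ A, ∀ y' ∈ B, (x ≠ x' ∨ y ≠ y') →
    ∀ e ∈ E x y, e ∉ E x' y'

/-- `Hᶜ` contains an immersion of `K_{a,b}` inside the vertex set `S`. -/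
def HasBicliqueIn {V : Type*} (H : SimpleGraph V) (S : Finset V) (a b : ℕ) : Prop :=
  ∃ A B E, IsBicliqueIn H S A B E ∧ #A = a ∧ #B = b

section
variable {V : Type*} {H : SimpleGraph V} {S : Finset V}

theorem HasBicliqueIn.symm {a b : ℕ} (h : HasBicliqueIn H S a b) : HasBicliqueIn H S b a := by
  obtain ⟨A, B, E, h, ha, hb⟩ := h
  refine ⟨B, A, fun x y => E y x, ⟨h.2, h.1, h.3.symm, ?_, fun x hx y hy => h.5 y hy x hx, ?_⟩,
    hb, ha⟩
  · intro x hx y hy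
    obtain ⟨w, hw⟩ := h.walk y hy x hx
    exact ⟨w.reverse, fun e he => hw e (by simpa using he)⟩
  · intro x hx y hy x' hx' y' hy' hne
    exact h.edge_disj y hy x hx y' hy' x' hx' hne.symm

theorem HasBicliqueIn.containsImmersion {G : SimpleGraph V} {a b : ℕ}
    (h : HasBicliqueIn Gᶜ S a b) :
    G.ContainsImmersion (completeBipartiteGraph (Fin a) (Fin b)) := by
  classical
  obtain ⟨A, B, E, h, rfl, rfl⟩ := h
  obtain ⟨hA, hB, hd, hw, -, he⟩ := h
  rw [compl_compl] at hw
  let α : Fin #A → V := fun i => A.equivFin.symm i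
  let β : Fin #B → V := fun i => B.equivFin.symm i
  have hα : ∀ i, α i ∈ A := fun i => (A.equivFin.symm i).2
  have hβ : ∀ i, β i ∈ B := fun i => (B.equivFin.symm i).2
  have hαi : Function.Injective α := Subtype.val_injective.comp A.equivFin.symm.injective
  have hβi : Function.Injective β := Subtype.val_injective.comp B.equivFin.symm.injective
  let φ : Fin #A ⊕ Fin #B ↪ V := ⟨Sum.elim α β, hαi.sumElim hβi fun i j hij =>
    Finset.disjoint_left.1 hd (hα i) (hij ▸ hβ j)⟩
  have key : ∀ d : (completeBipartiteGraph (Fin #A) (Fin #B)).Dart,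
      ∃ (p : G.Path (φ d.fst) (φ d.snd)) (i : Fin #A) (j : Fin #B),
        d.edge = s(Sum.inl i, Sum.inr j) ∧ ∀ e ∈ p.val.edges, e ∈ E (α i) (β j) := by
    rintro ⟨⟨x | x, y | y⟩, hxy⟩
    · simp at hxy
    · obtain ⟨w, hw⟩ := hw (α x) (hα x) (β y) (hβ y)
      exact ⟨w.toPath, x, y, rfl, fun e he => hw e (w.edges_toPath_subset_edges he)⟩
    · obtain ⟨w, hw⟩ := hw (α y) (hα y) (β x) (hβ x)
      exact ⟨w.reverse.toPath, y, x, Sym2.eq_swap, fun e he => hw e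
        (by simpa using w.reverse.edges_toPath_subset_edges he)⟩
    · simp at hxy
  choose p i j hij hp using key
  refine ⟨φ, p, fun d d' hne e hed hed' => ?_⟩
  refine he _ (hα (i d)) _ (hβ (j d)) _ (hα (i d')) _ (hβ (j d')) ?_ e (hp d e hed) (hp d' e hed')
  by_contra! hc
  exact hne (by rw [hij d, hij d', hαi hc.1, hβi hc.2])

/-- Nonadjacent pairs of `A × B` are joined by paths of length two with middle vertices outside
`A ∪ B`, different for pairs sharing a vertex. -/
theorem isBicliqueIn_of_middle [DecidableEq V] {A B : Finset V} (hA : A ⊆ S) (hB : B ⊆ S)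
    (hAB : Disjoint A B) (f : V → V → V)
    (hf : ∀ x ∈ A, ∀ y ∈ B, H.Adj x y → f x y ∈ S ∧ f x y ∉ A ∧ f x y ∉ B ∧
      ¬ H.Adj x (f x y) ∧ ¬ H.Adj (f x y) y)
    (hl : ∀ x ∈ A, ∀ y ∈ B, ∀ y' ∈ B, H.Adj x y → H.Adj x y' → f x y = f x y' → y = y')
    (hr : ∀ x ∈ A, ∀ x' ∈ A, ∀ y ∈ B, H.Adj x y → H.Adj x' y → f x y = f x' y → x = x') :
    ∃ E, IsBicliqueIn H S A B E := by
  classical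
  have hne : ∀ x ∈ A, ∀ y ∈ B, x ≠ y := fun x hx y hy h =>
    Finset.disjoint_left.1 hAB hx (h ▸ hy)
  refine ⟨fun x y => if H.Adj x y then {s(x, f x y), s(f x y, y)} else {s(x, y)},
    hA, hB, hAB, ?_, ?_, ?_⟩
  · intro x hx y hy
    by_cases h : H.Adj x y
    · obtain ⟨h1, h2, h3, h4, h5⟩ := hf x hx y hy h
      have e1 : Hᶜ.Adj x (f x y) := ⟨fun h => h2 (h ▸ hx), h4⟩
      have e2 : Hᶜ.Adj (f x y) y := ⟨fun h => h3 (h.symm ▸ hy), h5⟩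
      refine ⟨.cons e1 (.cons e2 .nil), ?_⟩
      simp [h]
    · have e1 : Hᶜ.Adj x y := ⟨hne x hx y hy, h⟩
      refine ⟨.cons e1 .nil, ?_⟩
      simp [h]
  · intro x hx y hy e he z hz
    have := hA hx
    have := hB hy
    by_cases h : H.Adj x y
    · have := (hf x hx y hy h).1
      simp only [h, if_true, Set.mem_insert_iff, Set.mem_singleton_iff] at he
      rcases he with rfl | rfl <;> simp at hz <;> rcases hz with rfl | rfl <;> assumption
    · simp only [h, if_false, Set.mem_singleton_iff] at he
      subst he
      simp at hz; rcases hz with rfl | rfl <;> assumption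
  · intro x hx y hy x' hx' y' hy' hn e he he'
    have := hf x hx y hy
    have := hf x' hx' y' hy'
    have := hne x hx y hy
    have := hne x hx y' hy'
    have := hne x' hx' y hy
    have := hl x hx y hy y' hy'
    have := hr x hx x' hx' y hy
    by_cases h : H.Adj x y <;> by_cases h' : H.Adj x' y' <;>
      simp only [h, h', if_true, if_false, Set.mem_insert_iff, Set.mem_singleton_iff] at he he'
    · rcases he with rfl | rfl <;> simp only [Sym2.eq_iff] at he' <;> grind
    · rcases he with rfl | rfl <;> simp only [Sym2.eq_iff] at he' <;> grind
    · subst he; simp only [Sym2.eq_iff] at he'; grind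
    · subst he; simp only [Sym2.eq_iff] at he'; grind

theorem hasBicliqueIn_of_indep {I : Finset V} (hI : I ⊆ S) {l m : ℕ} (hc : m ≤ #I) (hl : l ≤ m)
    (h : ∀ x ∈ I, ∀ y ∈ I, ¬ H.Adj x y) : HasBicliqueIn H S l (m - l) := by
  classical
  obtain ⟨A, hA, hAc⟩ := Finset.exists_subset_card_eq (hl.trans hc)
  have : m - l ≤ #(I \ A) := by rw [card_sdiff_of_subset hA]; omega
  obtain ⟨B, hB, hBc⟩ := Finset.exists_subset_card_eq this
  have hBI : B ⊆ I := hB.trans sdiff_subset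
  obtain ⟨E, hE⟩ := isBicliqueIn_of_middle (H := H) (hA.trans hI) (hBI.trans hI)
    (Finset.disjoint_left.2 fun x hx hx' => (mem_sdiff.1 (hB hx')).2 hx) (fun x _ => x)
    (fun x hx y hy e => (h x (hA hx) y (hBI hy) e).elim)
    (fun x hx y hy _ _ e => (h x (hA hx) y (hBI hy) e).elim)
    (fun x hx _ _ y hy e => (h x (hA hx) y (hBI hy) e).elim)
  exact ⟨A, B, E, hE, hAc, hBc⟩

/-! ### Enlarging one side at the cost of two vertices -/

/-- Every new edge contains `u` or `v`, while the old ones avoid both. The new paths `a, v, g a, u`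
do not meet each other because `g` is injective and takes values outside `A`; values in `B` do no
harm. -/
theorem IsBicliqueIn.insert_right [DecidableEq V] {A B : Finset V} {E : V → V → Set (Sym2 V)}
    {u v : V} (hu : u ∈ S) (hv : v ∈ S) (huv : u ≠ v)
    (h : IsBicliqueIn H ((S.erase u).erase v) A B E) (g : V → V)
    (hg : ∀ a ∈ A, H.Adj u a → g a ∈ S ∧ g a ∉ A ∧ g a ≠ u ∧ g a ≠ v ∧ ¬ H.Adj u (g a) ∧
      ¬ H.Adj v (g a) ∧ ¬ H.Adj v a)
    (hgi : ∀ a ∈ A, ∀ a' ∈ A, H.Adj u a → H.Adj u a' → g a = g a' → a = a') :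
    ∃ E', IsBicliqueIn H S A (insert u B) E' := by
  classical
  obtain ⟨hA, hB, hAB, hw, hs, he⟩ := h
  have hAS : ∀ a ∈ A, a ∈ S ∧ a ≠ u ∧ a ≠ v := fun a ha => by have := hA ha; simp at this; tauto
  have hBS : ∀ a ∈ B, a ∈ S ∧ a ≠ u ∧ a ≠ v := fun a ha => by have := hB ha; simp at this; tauto
  have hs' : ∀ x ∈ A, ∀ y ∈ B, ∀ e ∈ E x y, u ∉ e ∧ v ∉ e := fun x hx y hy e hxy =>
    ⟨fun hh => by simpa using hs x hx y hy e hxy u hh,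
      fun hh => by simpa using hs x hx y hy e hxy v hh⟩
  let F : V → Set (Sym2 V) := fun x =>
    if H.Adj u x then {s(u, g x), s(g x, v), s(v, x)} else {s(u, x)}
  have hF : ∀ x, ∀ e ∈ F x, u ∈ e ∨ v ∈ e := by
    intro x e hx
    by_cases hux : H.Adj u x
    · simp only [F, hux, if_true, Set.mem_insert_iff, Set.mem_singleton_iff] at hx
      rcases hx with rfl | rfl | rfl <;> simp
    · simp only [F, hux, if_false, Set.mem_singleton_iff] at hx
      subst hx; simp
  refine ⟨fun x y => if y = u then F x else E x y, fun a ha => (hAS a ha).1, ?_, ?_, ?_, ?_, ?_⟩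
  · intro b hb
    rcases mem_insert.1 hb with rfl | hb
    exacts [hu, (hBS b hb).1]
  · rw [Finset.disjoint_insert_right]
    exact ⟨fun h => (hAS u h).2.1 rfl, hAB⟩
  · intro x hx y hy
    by_cases hyu : y = u
    · subst hyu
      by_cases hux : H.Adj y x
      · obtain ⟨h1, h2, h3, h4, h5, h6, h7⟩ := hg x hx hux
        have e1 : Hᶜ.Adj x v := ⟨(hAS x hx).2.2, fun h => h7 h.symm⟩
        have e2 : Hᶜ.Adj v (g x) := ⟨h4.symm, h6⟩
        have e3 : Hᶜ.Adj (g x) y := ⟨h3, fun h => h5 h.symm⟩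
        refine ⟨.cons e1 (.cons e2 (.cons e3 .nil)), ?_⟩
        simp [F, hux, Sym2.eq_swap]
      · have e1 : Hᶜ.Adj x y := ⟨(hAS x hx).2.1, fun h => hux h.symm⟩
        refine ⟨.cons e1 .nil, ?_⟩
        simp [F, hux, Sym2.eq_swap]
    · simpa [hyu] using hw x hx y (by simpa [hyu] using hy)
  · intro x hx y hy e hxy z hz
    by_cases hyu : y = u
    · have := (hAS x hx).1
      by_cases hux : H.Adj u x
      · have := (hg x hx hux).1
        simp only [hyu, F, hux, if_true, Set.mem_insert_iff, Set.mem_singleton_iff] at hxy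
        rcases hxy with rfl | rfl | rfl <;> simp at hz <;> rcases hz with rfl | rfl <;> assumption
      · simp only [hyu, F, hux, if_true, if_false, Set.mem_singleton_iff] at hxy
        subst hxy
        simp at hz; rcases hz with rfl | rfl <;> assumption
    · simp only [hyu, if_false] at hxy
      have := hs x hx y (by simpa [hyu] using hy) e hxy z hz
      simp at this; tauto
  · intro x hx y hy x' hx' y' hy' hn e hxy hxy'
    by_cases hyu : y = u <;> by_cases hyu' : y' = u
    · simp only [hyu, hyu', if_true] at hxy hxy'
      have := hg x hx
      have := hg x' hx'
      have := hAS x hx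
      have := hAS x' hx'
      have := hgi x hx x' hx'
      have : x ≠ x' := by rcases hn with h | h; exacts [h, (h (hyu.trans hyu'.symm)).elim]
      by_cases h : H.Adj u x <;> by_cases h' : H.Adj u x' <;>
        simp only [F, h, h', if_true, if_false, Set.mem_insert_iff, Set.mem_singleton_iff]
          at hxy hxy'
      · rcases hxy with rfl | rfl | rfl <;> simp only [Sym2.eq_iff] at hxy' <;> grind
      · rcases hxy with rfl | rfl | rfl <;> simp only [Sym2.eq_iff] at hxy' <;> grind
      · subst hxy; simp only [Sym2.eq_iff] at hxy'; grind
      · subst hxy; simp only [Sym2.eq_iff] at hxy'; grind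
    · simp only [hyu, hyu', if_true, if_false] at hxy hxy'
      have := hs' x' hx' y' (by simpa [hyu'] using hy') e hxy'
      have := hF x e hxy
      tauto
    · simp only [hyu, hyu', if_true, if_false] at hxy hxy'
      have := hs' x hx y (by simpa [hyu] using hy) e hxy
      have := hF x' e hxy'
      tauto
    · simp only [hyu, hyu', if_false] at hxy hxy'
      exact he x hx y (by simpa [hyu] using hy) x' hx' y' (by simpa [hyu'] using hy') hn e hxy hxy'

/-! ### Injections and Latin rectangles -/

theorem exists_injOn_of_card_le {s t : Finset V} (h : #s ≤ #t) :
    ∃ f : V → V, (∀ x ∈ s, f x ∈ t) ∧ ∀ x ∈ s, ∀ y ∈ s, f x = f y → x = y := by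
  classical
  obtain ⟨e⟩ := Function.Embedding.nonempty_of_card_le (α := s) (β := t) (by simpa using h)
  refine ⟨fun x => if hx : x ∈ s then e ⟨x, hx⟩ else x, fun x hx => by simp [hx], ?_⟩
  intro x hx y hy hxy
  simp only [hx, hy, dif_pos] at hxy
  simpa using e.injective (Subtype.ext hxy)

/-- A Latin rectangle with rows `X`, columns `Y` and symbols `C`. -/
theorem exists_latin_rectangle {X Y C : Finset V} (hX : #X ≤ #C) (hY : #Y ≤ #C) :
    ∃ g : V → V → V, (∀ x ∈ X, ∀ y ∈ Y, g x y ∈ C) ∧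
      (∀ x ∈ X, ∀ y ∈ Y, ∀ y' ∈ Y, g x y = g x y' → y = y') ∧
      ∀ x ∈ X, ∀ x' ∈ X, ∀ y ∈ Y, g x y = g x' y → x = x' := by
  rcases Nat.eq_zero_or_pos #C with h0 | hpos
  · have : X = ∅ := card_eq_zero.1 (by omega)
    subst this
    exact ⟨fun x _ => x, by simp, by simp, by simp⟩
  have : NeZero #C := ⟨hpos.ne'⟩
  have hcard : Fintype.card (ZMod #C) = #C := ZMod.card _
  have lab : ∀ Z : Finset V, #Z ≤ #C → ∃ r : V → ZMod #C, ∀ x ∈ Z, ∀ y ∈ Z, r x = r y → x = y := by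
    intro Z hZ
    classical
    obtain ⟨e⟩ := Function.Embedding.nonempty_of_card_le (α := Z) (β := ZMod #C)
      (by rw [hcard]; simpa using hZ)
    refine ⟨fun x => if hx : x ∈ Z then e ⟨x, hx⟩ else 0, ?_⟩
    intro x hx y hy hxy
    simp only [hx, hy, dif_pos] at hxy
    simpa using e.injective hxy
  obtain ⟨r, hr⟩ := lab X hX
  obtain ⟨s, hs⟩ := lab Y hY
  let e : ZMod #C ≃ C := Fintype.equivOfCardEq (by simp)
  -- The addition table of a cyclic group is a Latin square; rows and columns are injectively
  -- labelled by its elements.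
  refine ⟨fun x y => e (r x + s y), fun x _ y _ => (e _).2, ?_, ?_⟩
  · intro x _ y hy y' hy' h
    exact hs y hy y' hy' (by simpa using e.injective (Subtype.ext h))
  · intro x hx x' hx' y _ h
    exact hr x hx x' hx' (by simpa using e.injective (Subtype.ext h))

/-! ### Neighbourhoods and the two inductive steps -/

open Classical in
/-- The neighbours of `u` inside `S`. -/
noncomputable def SimpleGraph.nbrsIn (H : SimpleGraph V) (S : Finset V) (u : V) : Finset V :=
  {z ∈ S | H.Adj u z}

@[simp] theorem SimpleGraph.mem_nbrsIn {u z : V} : z ∈ H.nbrsIn S u ↔ z ∈ S ∧ H.Adj u z := by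
  simp [SimpleGraph.nbrsIn]

theorem SimpleGraph.disjoint_nbrsIn (htf : ∀ a b c, H.Adj a b → H.Adj b c → ¬ H.Adj a c) {u v : V}
    (h : H.Adj u v) : Disjoint (H.nbrsIn S u) (H.nbrsIn S v) := by
  rw [Finset.disjoint_left]
  intro z hz hz'
  simp only [SimpleGraph.mem_nbrsIn] at hz hz'
  exact htf u v z h hz'.2 hz.2

theorem HasBicliqueIn.succ_right_of_edge [DecidableEq V]
    (htf : ∀ a b c, H.Adj a b → H.Adj b c → ¬ H.Adj a c)
    {u v : V} (hu : u ∈ S) (hv : v ∈ S) (huv : H.Adj u v) {l k : ℕ}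
    (hd : #(H.nbrsIn S u) + #(H.nbrsIn S v) + l ≤ #S)
    (h : HasBicliqueIn H ((S.erase u).erase v) l k) : HasBicliqueIn H S l (k + 1) := by
  classical
  obtain ⟨A, B, E, h, hA, hB⟩ := h
  let R := S \ (H.nbrsIn S u ∪ H.nbrsIn S v)
  have hsub : H.nbrsIn S u ∪ H.nbrsIn S v ⊆ S := by intro z; simp; tauto
  have hR : l ≤ #R := by
    rw [card_sdiff_of_subset hsub, card_union_of_disjoint (SimpleGraph.disjoint_nbrsIn htf huv)]
    omega
  -- `R` misses the neighbours of `u`, so the members of `A` needing a detour and those lying in `R`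
  -- together number at most `l ≤ #R`.
  have hle : #{a ∈ A | H.Adj u a} ≤ #(R \ A) := by
    have h1 : #(A ∩ R) + #(R \ A) = #R := by rw [inter_comm, add_comm]; exact card_sdiff_add_card_inter R A
    have h2 : #{a ∈ A | H.Adj u a} + #(A ∩ R) ≤ #A := by
      rw [← card_union_of_disjoint]
      · exact card_le_card (by intro z; simp; tauto)
      · rw [Finset.disjoint_left]
        intro z hz hz'
        simp [R] at hz hz'
        tauto
    omega
  obtain ⟨g, hg, hgi⟩ := exists_injOn_of_card_le hle
  obtain ⟨E', hE'⟩ := h.insert_right hu hv huv.ne g (fun a ha hua => by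
    have := hg a (by simp [ha, hua])
    have hnv : ¬ H.Adj v a := fun hva => htf u v a huv hva hua
    simp [R] at this
    obtain ⟨⟨h1, h2⟩, h3⟩ := this
    refine ⟨h1, h3, ?_, ?_, fun hh => h2.1 h1 hh, fun hh => h2.2 h1 hh, hnv⟩
    · intro e; rw [e] at h2; exact h2.2 hu huv.symm
    · intro e; rw [e] at h2; exact h2.1 hv huv)
    (fun a ha a' ha' hua hua' => hgi a (by simp [ha, hua]) a' (by simp [ha', hua']))
  refine ⟨A, insert u B, E', hE', hA, ?_⟩
  rw [card_insert_of_notMem, hB]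
  intro hub
  simpa using h.right_subset hub

theorem HasBicliqueIn.succ_right_of_isolated [DecidableEq V] {u v : V} (hu : u ∈ S) (hv : v ∈ S)
    (huv : u ≠ v) (hiso : ∀ z ∈ S, ¬ H.Adj u z) {l k : ℕ}
    (h : HasBicliqueIn H ((S.erase u).erase v) l k) : HasBicliqueIn H S l (k + 1) := by
  obtain ⟨A, B, E, h, hA, hB⟩ := h
  have hAS : ∀ a ∈ A, a ∈ S := fun a ha => by have := h.left_subset ha; simp at this; tauto
  obtain ⟨E', hE'⟩ := h.insert_right hu hv huv (fun x => x)
    (fun a ha hua => (hiso a (hAS a ha) hua).elim) (fun _ _ _ _ _ _ hh => hh)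
  refine ⟨A, insert u B, E', hE', hA, ?_⟩
  rw [card_insert_of_notMem, hB]
  intro hub
  simpa using h.right_subset hub

/-! ### Dense triangle-free graphs: finding the five-cycle -/

/-- In a dense triangle-free graph without large independent sets there is a closed walk of
length five. -/
theorem exists_five_cycle (htf : ∀ a b c, H.Adj a b → H.Adj b c → ¬ H.Adj a c) {m l : ℕ}
    (hS : #S + 1 = 2 * m) (hl : 2 * l ≤ m)
    (hiso : ∀ u ∈ S, ∃ v ∈ S, H.Adj u v)
    (hdeg : ∀ u ∈ S, ∀ v ∈ S, H.Adj u v → 2 * m ≤ #(H.nbrsIn S u) + #(H.nbrsIn S v) + l)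
    (hmax : ∀ I ⊆ S, (∀ x ∈ I, ∀ y ∈ I, ¬ H.Adj x y) → #I < m) :
    ∃ v : ZMod 5 → V, (∀ i, v i ∈ S) ∧ ∀ i, H.Adj (v i) (v (i + 1)) := by
  classical
  by_contra hno
  have h5 : ∀ a ∈ S, ∀ b ∈ S, ∀ c ∈ S, ∀ d ∈ S, ∀ e ∈ S, H.Adj a b → H.Adj b c → H.Adj c d →
      H.Adj d e → H.Adj e a → False := by
    intro a ha b hb c hc d hd e he h1 h2 h3 h4 h5
    refine hno ⟨(![a, b, c, d, e] : Fin 5 → V), fun i => ?_, fun i => ?_⟩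
    · change Fin 5 at i; fin_cases i <;> assumption
    · change Fin 5 at i; fin_cases i <;> assumption
  have hd1 : ∀ r ∈ S, #(H.nbrsIn S r) < m := fun r hr => hmax _ (fun z => by simp; tauto)
    fun x hx y hy hxy => by
      simp at hx hy
      exact htf r x y hx.2 hxy hy.2
  obtain ⟨u, hu⟩ : S.Nonempty := card_pos.1 (by omega)
  obtain ⟨v, hv, huv⟩ := hiso u hu
  let X := H.nbrsIn S u
  let Y := H.nbrsIn S v
  have hXY : Disjoint X Y := SimpleGraph.disjoint_nbrsIn htf huv
  have hX : ∀ x, x ∈ X ↔ x ∈ S ∧ H.Adj u x := fun x => SimpleGraph.mem_nbrsIn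
  have hY : ∀ x, x ∈ Y ↔ x ∈ S ∧ H.Adj v x := fun x => SimpleGraph.mem_nbrsIn
  have hsub : X ∪ Y ⊆ S := by intro z; simp [hX, hY]; tauto
  -- Otherwise `r` has degree at most `l - 1`, and a neighbour of `r` has degree at most `m - 1`,
  -- too little for the degree condition since `2l ≤ m`.
  have hrest : ∀ r ∈ S, ∃ z, (z ∈ X ∨ z ∈ Y) ∧ H.Adj r z := by
    intro r hr
    by_contra! hc
    have h1 : #(H.nbrsIn S r) ≤ #(S \ (X ∪ Y)) := card_le_card fun z hz => by
      simp at hz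
      have := hc z
      simp
      tauto
    rw [card_sdiff_of_subset hsub, card_union_of_disjoint hXY] at h1
    have h2 := hdeg u hu v hv huv
    obtain ⟨s, hs, hrs⟩ := hiso r hr
    have h3 := hdeg r hr s hs hrs
    have h4 := hd1 s hs
    have : 2 * m ≤ #X + #Y + l := h2
    omega
  -- `I` and `S \ I` would be a bipartition of `H` on `S`: an edge inside either part closes a
  -- triangle or a five-cycle. One of them then has at least `m` of the `2m - 1` vertices.
  let I := {r ∈ S | r ∈ X ∨ (r ∉ Y ∧ ∃ y ∈ Y, H.Adj r y)}
  have hI : ∀ x ∈ I, ∀ y ∈ I, ¬ H.Adj x y := by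
    intro x hx y hy hxy
    simp only [I, mem_filter] at hx hy
    obtain ⟨hxS, hx⟩ := hx
    obtain ⟨hyS, hy⟩ := hy
    rcases hx with hx | ⟨-, a, ha, hxa⟩ <;> rcases hy with hy | ⟨-, b, hb, hyb⟩
    · exact htf u x y ((hX x).1 hx).2 hxy ((hX y).1 hy).2
    · exact h5 u hu x hxS y hyS b ((hY b).1 hb).1 v hv ((hX x).1 hx).2 hxy hyb
        ((hY b).1 hb).2.symm huv.symm
    · exact h5 u hu y hyS x hxS a ((hY a).1 ha).1 v hv ((hX y).1 hy).2 hxy.symm hxa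
        ((hY a).1 ha).2.symm huv.symm
    · exact h5 v hv a ((hY a).1 ha).1 x hxS y hyS b ((hY b).1 hb).1 ((hY a).1 ha).2 hxa.symm hxy
        hyb ((hY b).1 hb).2.symm
  have hJ : ∀ x ∈ S \ I, ∀ y ∈ S \ I, ¬ H.Adj x y := by
    have hJ' : ∀ x ∈ S \ I, x ∈ S ∧ x ∉ X ∧ (x ∈ Y ∨ (∀ y ∈ Y, ¬ H.Adj x y) ∧
        ∃ z ∈ X, H.Adj x z) := by
      intro x hx
      simp only [I, mem_sdiff, mem_filter] at hx
      obtain ⟨z, hz, hxz⟩ := hrest x hx.1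
      refine ⟨hx.1, fun h => hx.2 ⟨hx.1, .inl h⟩, ?_⟩
      by_cases hxY : x ∈ Y
      · exact .inl hxY
      · have hn : ∀ y ∈ Y, ¬ H.Adj x y := fun y hy hxy => hx.2 ⟨hx.1, .inr ⟨hxY, y, hy, hxy⟩⟩
        exact .inr ⟨hn, z, hz.resolve_right fun h => hn z h hxz, hxz⟩
    intro x hx y hy hxy
    obtain ⟨hxS, -, hx⟩ := hJ' x hx
    obtain ⟨hyS, -, hy⟩ := hJ' y hy
    rcases hx with hx | ⟨hx, a, ha, hxa⟩ <;> rcases hy with hy | ⟨hy, b, hb, hyb⟩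
    · exact htf v x y ((hY x).1 hx).2 hxy ((hY y).1 hy).2
    · exact hy x hx hxy.symm
    · exact hx y hy hxy
    · exact h5 u hu a ((hX a).1 ha).1 x hxS y hyS b ((hX b).1 hb).1 ((hX a).1 ha).2 hxa.symm hxy
        hyb ((hX b).1 hb).2.symm
  have hIS : I ⊆ S := filter_subset _ _
  have h1 := hmax I hIS hI
  have h2 := hmax (S \ I) sdiff_subset hJ
  rw [card_sdiff_of_subset hIS] at h2
  omega

/-! ### Dense triangle-free graphs: homomorphism to the five-cycle -/

open Classical in
/-- The indicator of adjacency. -/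
noncomputable def SimpleGraph.adjInd (H : SimpleGraph V) (u z : V) : ℕ := if H.Adj u z then 1 else 0

theorem SimpleGraph.card_nbrsIn (u : V) : #(H.nbrsIn S u) = ∑ z ∈ S, H.adjInd u z := by
  simp [SimpleGraph.nbrsIn, SimpleGraph.adjInd]

theorem SimpleGraph.adjInd_add_le (htf : ∀ a b c, H.Adj a b → H.Adj b c → ¬ H.Adj a c) {a b : V}
    (h : H.Adj a b) (z : V) : H.adjInd a z + H.adjInd b z ≤ 1 := by
  have := htf a b z h
  unfold SimpleGraph.adjInd; split_ifs  <;> (simp; try tauto)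

/-- Double counting: the eight degrees sum to at least `4(2m - l) ≥ 6m`, but to at most `3(2m - 1)`.
The edges may share end points, which are then counted with multiplicity. -/
theorem four_edges_false {m l : ℕ}
    (hS : #S + 1 = 2 * m) (hl : 2 * l ≤ m)
    (hdeg : ∀ u ∈ S, ∀ v ∈ S, H.Adj u v → 2 * m ≤ #(H.nbrsIn S u) + #(H.nbrsIn S v) + l)
    (x y : Fin 4 → V) (hx : ∀ i, x i ∈ S) (hy : ∀ i, y i ∈ S) (hxy : ∀ i, H.Adj (x i) (y i))
    (h : ∀ z ∈ S, ∑ i, (H.adjInd (x i) z + H.adjInd (y i) z) ≤ 3) : False := by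
  have h1 : ∑ i : Fin 4, (2 * m) ≤ ∑ i, (#(H.nbrsIn S (x i)) + #(H.nbrsIn S (y i)) + l) :=
    sum_le_sum fun i _ => hdeg _ (hx i) _ (hy i) (hxy i)
  have h2 : ∑ z ∈ S, ∑ i, (H.adjInd (x i) z + H.adjInd (y i) z) ≤ #S * 3 :=
    sum_le_card_nsmul _ _ _ h
  rw [sum_comm] at h2
  simp only [sum_add_distrib (s := S), ← SimpleGraph.card_nbrsIn] at h2
  rw [sum_add_distrib] at h1
  simp at h1
  omega

/-- The adjacencies of a vertex to a closed walk of length five in a triangle-free graph. -/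
theorem adjInd_five_cycle (htf : ∀ a b c, H.Adj a b → H.Adj b c → ¬ H.Adj a c) {v : ZMod 5 → V}
    (hv : ∀ i, H.Adj (v i) (v (i + 1))) (i : ZMod 5) (z : V) :
    H.adjInd (v i) z + H.adjInd (v (i + 1)) z ≤ 1 ∧
    H.adjInd (v (i + 1)) z + H.adjInd (v (i + 2)) z ≤ 1 ∧
    H.adjInd (v (i + 2)) z + H.adjInd (v (i + 3)) z ≤ 1 ∧
    H.adjInd (v (i + 3)) z + H.adjInd (v (i + 4)) z ≤ 1 ∧
    H.adjInd (v (i + 4)) z + H.adjInd (v i) z ≤ 1 := by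
  have key : ∀ j k, k = j + 1 → H.adjInd (v j) z + H.adjInd (v k) z ≤ 1 := by
    rintro j k rfl
    exact SimpleGraph.adjInd_add_le htf (hv j) z
  refine ⟨key _ _ rfl, key _ _ ?_, key _ _ ?_, key _ _ ?_, key _ _ ?_⟩ <;> revert i <;> decide

/-- No neighbour of `w` in `S` is adjacent to both `v (i - 1)` and `v (i + 1)`. -/
def AvoidsClass (H : SimpleGraph V) (S : Finset V) (v : ZMod 5 → V) (w : V) (i : ZMod 5) : Prop :=
  ∀ z ∈ S, H.Adj w z → H.Adj (v (i + 4)) z → ¬ H.Adj (v (i + 1)) z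

theorem AvoidsClass.adjInd_le {v : ZMod 5 → V} {w : V} {i : ZMod 5} (h : AvoidsClass H S v w i)
    {z : V} (hz : z ∈ S) :
    H.adjInd w z + H.adjInd (v (i + 4)) z + H.adjInd (v (i + 1)) z ≤ 2 := by
  have := h z hz
  unfold SimpleGraph.adjInd; split_ifs <;> (simp; try tauto)

/-- Witnesses `x`, `y` against both alternatives, together with `w` and the cycle, form eight
vertices covered by four edges. The neighbours of any `z` among them are independent, and no four of
the eight are. -/
theorem avoidsClass_or_succ (htf : ∀ a b c, H.Adj a b → H.Adj b c → ¬ H.Adj a c) {m l : ℕ}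
    (hS : #S + 1 = 2 * m) (hl : 2 * l ≤ m)
    (hdeg : ∀ u ∈ S, ∀ v ∈ S, H.Adj u v → 2 * m ≤ #(H.nbrsIn S u) + #(H.nbrsIn S v) + l)
    {v : ZMod 5 → V} (hvS : ∀ i, v i ∈ S) (hv : ∀ i, H.Adj (v i) (v (i + 1)))
    {w : V} (hw : w ∈ S) (i : ZMod 5) :
    AvoidsClass H S v w i ∨ AvoidsClass H S v w (i + 1) := by
  by_contra! hc
  simp only [AvoidsClass, not_forall, not_not] at hc
  obtain ⟨⟨x, hx, hwx, hx4, hx1⟩, y, hy, hwy, hy0, hy2⟩ := hc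
  rw [show i + 1 + 4 = i by clear * -; decide +revert] at hy0
  rw [show i + 1 + 1 = i + 2 by clear * -; decide +revert] at hy2
  have h34 : H.Adj (v (i + 3)) (v (i + 4)) := by
    have := hv (i + 3); rwa [show i + 3 + 1 = i + 4 by clear * -; decide +revert] at this
  refine four_edges_false hS hl hdeg ![w, y, v (i + 3), v i] ![x, v (i + 2), v (i + 4), v (i + 1)]
    ?_ ?_ ?_ ?_
  · intro k; fin_cases k <;> simp [*]
  · intro k; fin_cases k <;> simp [*]
  · intro k; fin_cases k <;> simp [*, hy2.symm]
  · intro z _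
    have h5 := adjInd_five_cycle htf hv i z
    have h1 := SimpleGraph.adjInd_add_le htf hwx z
    have h2 := SimpleGraph.adjInd_add_le htf hwy z
    have h3 := SimpleGraph.adjInd_add_le htf hx4 z
    have h4 := SimpleGraph.adjInd_add_le htf hx1 z
    have h6 := SimpleGraph.adjInd_add_le htf hy0 z
    have h7 := SimpleGraph.adjInd_add_le htf hy2 z
    simp [Fin.sum_univ_four]
    omega

/-- Here `v (i + 1)` is counted twice. A vertex adjacent to three cycle entries, so counted, is
adjacent to `v (i + 1)` and to `v (i + 3)` or `v (i + 4)`; the avoided classes forbid its adjacency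
to `w` or `z`. -/
theorem AvoidsClass.not_adj (htf : ∀ a b c, H.Adj a b → H.Adj b c → ¬ H.Adj a c) {m l : ℕ}
    (hS : #S + 1 = 2 * m) (hl : 2 * l ≤ m)
    (hdeg : ∀ u ∈ S, ∀ v ∈ S, H.Adj u v → 2 * m ≤ #(H.nbrsIn S u) + #(H.nbrsIn S v) + l)
    {v : ZMod 5 → V} (hvS : ∀ i, v i ∈ S) (hv : ∀ i, H.Adj (v i) (v (i + 1)))
    {w z : V} (hw : w ∈ S) (hz : z ∈ S) {i : ZMod 5} (hw0 : AvoidsClass H S v w i)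
    (hw2 : AvoidsClass H S v w (i + 2)) (hz0 : AvoidsClass H S v z i)
    (hz2 : AvoidsClass H S v z (i + 2)) : ¬ H.Adj w z := by
  intro hwz
  have h34 : H.Adj (v (i + 3)) (v (i + 4)) := by
    have := hv (i + 3); rwa [show i + 3 + 1 = i + 4 by clear * -; decide +revert] at this
  have h12 : H.Adj (v (i + 1)) (v (i + 2)) := by
    have := hv (i + 1); rwa [show i + 1 + 1 = i + 2 by clear * -; decide +revert] at this
  refine four_edges_false hS hl hdeg ![w, v (i + 3), v i, v (i + 1)]
    ![z, v (i + 4), v (i + 1), v (i + 2)] ?_ ?_ ?_ ?_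
  · intro k; fin_cases k <;> simp [*]
  · intro k; fin_cases k <;> simp [*]
  · intro k; fin_cases k <;> simp [*]
  · intro t ht
    have h5 := adjInd_five_cycle htf hv i t
    have h1 := SimpleGraph.adjInd_add_le htf hwz t
    have e1 : i + 2 + 4 = i + 1 := by clear * -; decide +revert
    have e2 : i + 2 + 1 = i + 3 := by clear * -; decide +revert
    have h2 := hw0.adjInd_le ht
    have h3 := hw2.adjInd_le ht
    have h4 := hz0.adjInd_le ht
    have h6 := hz2.adjInd_le ht
    rw [e1, e2] at h3 h6
    simp [Fin.sum_univ_four]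
    omega

open Classical in
/-- A dense triangle-free graph with a closed walk of length five is homomorphic to the
five-cycle, with all colour classes small and all neighbourhoods of classes large. -/
theorem exists_hom_five_cycle (htf : ∀ a b c, H.Adj a b → H.Adj b c → ¬ H.Adj a c) {m l : ℕ}
    (hS : #S + 1 = 2 * m) (hl : 2 * l ≤ m)
    (hdeg : ∀ u ∈ S, ∀ v ∈ S, H.Adj u v → 2 * m ≤ #(H.nbrsIn S u) + #(H.nbrsIn S v) + l)
    (hmax : ∀ I ⊆ S, (∀ x ∈ I, ∀ y ∈ I, ¬ H.Adj x y) → #I < m)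
    {v : ZMod 5 → V} (hvS : ∀ i, v i ∈ S) (hv : ∀ i, H.Adj (v i) (v (i + 1))) :
    ∃ c : V → ZMod 5, (∀ w ∈ S, ∀ z ∈ S, H.Adj w z → c z = c w + 1 ∨ c z = c w + 4) ∧
      (∀ j, #{w ∈ S | c w = j} < l) ∧
      ∀ j, m < #{w ∈ S | c w = j} + #{w ∈ S | c w = j + 2} + l := by
  have hd1 : ∀ r ∈ S, #(H.nbrsIn S r) < m := fun r hr => hmax _ (fun z => by simp; tauto)
    fun x hx y hy hxy => by
      simp at hx hy
      exact htf r x y hx.2 hxy hy.2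
  -- The classes not avoided by `w` are pairwise non-consecutive, so they lie in some `{j - 1, j +
  -- 1}`; this `j` becomes the colour of `w`.
  have hcl : ∀ w, ∃ j : ZMod 5, w ∈ S → AvoidsClass H S v w j ∧ AvoidsClass H S v w (j + 2) ∧
      AvoidsClass H S v w (j + 3) := by
    intro w
    by_cases hw : w ∈ S
    · have h0 := avoidsClass_or_succ htf hS hl hdeg hvS hv hw 0
      have h1 := avoidsClass_or_succ htf hS hl hdeg hvS hv hw 1
      have h2 := avoidsClass_or_succ htf hS hl hdeg hvS hv hw 2
      have h3 := avoidsClass_or_succ htf hS hl hdeg hvS hv hw 3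
      have h4 := avoidsClass_or_succ htf hS hl hdeg hvS hv hw 4
      generalize AvoidsClass H S v w = T at *
      have key : ∀ T : ZMod 5 → Bool, (T 0 ∨ T (0 + 1)) → (T 1 ∨ T (1 + 1)) → (T 2 ∨ T (2 + 1)) →
          (T 3 ∨ T (3 + 1)) → (T 4 ∨ T (4 + 1)) → ∃ j, T j ∧ T (j + 2) ∧ T (j + 3) := by
        decide
      obtain ⟨j, hj⟩ := key (fun j => decide (T j)) (by simpa using h0) (by simpa using h1)
        (by simpa using h2) (by simpa using h3) (by simpa using h4)
      exact ⟨j, fun _ => by simpa using hj⟩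
    · exact ⟨0, fun h => (hw h).elim⟩
  choose c hc using hcl
  have hsucc : ∀ i j, j = i + 1 → H.Adj (v i) (v j) := by rintro i j rfl; exact hv i
  have hav : ∀ w ∈ S, ∀ j, AvoidsClass H S v w j → ¬ H.Adj (v j) w := fun w hw j h hwj =>
    h (v j) (hvS j) hwj.symm (hsucc _ _ (by clear * -; decide +revert)) (hv j).symm
  refine ⟨c, ?_, ?_, ?_⟩
  · intro w hw z hz hwz
    obtain ⟨a0, a2, a3⟩ := hc w hw
    obtain ⟨b0, b2, b3⟩ := hc z hz
    -- For each of the three forbidden differences, both end points avoid two common classes at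
    -- distance two.
    have key : ∀ i k : ZMod 5, (k = i + 1 ∨ k = i + 4) ∨ k = i ∨ k = i + 2 ∨ k = i + 3 := by decide
    rcases key (c w) (c z) with h | h | h | h
    · exact h
    · rw [h] at b0 b2
      exact (AvoidsClass.not_adj htf hS hl hdeg hvS hv hw hz a0 a2 b0 b2 hwz).elim
    · rw [h] at b0 b3
      rw [show c w + 2 + 3 = c w by generalize c w = i; clear * -; decide +revert] at b3
      exact (AvoidsClass.not_adj htf hS hl hdeg hvS hv hw hz a0 a2 b3 b0 hwz).elim
    · rw [h] at b0 b2
      rw [show c w + 3 + 2 = c w by generalize c w = i; clear * -; decide +revert] at b2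
      have e : c w + 3 + 2 = c w := by generalize c w = i; clear * -; decide +revert
      exact (AvoidsClass.not_adj htf hS hl hdeg hvS hv hw hz a3 (by rwa [e]) b0 (by rwa [e]) hwz).elim
  · intro j
    have hadj : H.Adj (v (j + 2)) (v (j + 3)) := hsucc _ _ (by clear * -; decide +revert)
    have h1 := hdeg _ (hvS (j + 2)) _ (hvS (j + 3)) hadj
    -- Class `j` misses both neighbourhoods, whose disjoint union has at least `2m - l` of the `2m -
    -- 1` vertices.
    have h2 : Disjoint (H.nbrsIn S (v (j + 2)) ∪ H.nbrsIn S (v (j + 3))) {w ∈ S | c w = j} := by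
      rw [Finset.disjoint_left]
      intro z hz hz'
      simp at hz hz'
      obtain ⟨hzS, rfl⟩ := hz'
      obtain ⟨-, a2, a3⟩ := hc z hzS
      have := hav z hzS _ a2
      have := hav z hzS _ a3
      tauto
    have h3 : #((H.nbrsIn S (v (j + 2)) ∪ H.nbrsIn S (v (j + 3))) ∪ {w ∈ S | c w = j}) ≤ #S :=
      card_le_card (by intro z; simp; tauto)
    rw [card_union_of_disjoint h2,
      card_union_of_disjoint (SimpleGraph.disjoint_nbrsIn htf hadj)] at h3
    omega
  · intro j
    have hadj : H.Adj (v (j + 1)) (v (j + 2)) := hsucc _ _ (by clear * -; decide +revert)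
    have h1 := hdeg _ (hvS (j + 1)) _ (hvS (j + 2)) hadj
    have h2 := hd1 _ (hvS (j + 2))
    have h3 : #(H.nbrsIn S (v (j + 1))) ≤ #({w ∈ S | c w = j} ∪ {w ∈ S | c w = j + 2}) := by
      refine card_le_card fun z hz => ?_
      simp only [SimpleGraph.mem_nbrsIn] at hz
      obtain ⟨hzS, hz⟩ := hz
      obtain ⟨a0, a2, a3⟩ := hc z hzS
      simp only [mem_union, mem_filter, hzS, true_and]
      have key : ∀ i k : ZMod 5, (k = i ∨ k = i + 2) ∨ i + 1 = k ∨ i + 1 = k + 2 ∨ i + 1 = k + 3 := by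
        decide
      rcases key j (c z) with h | h | h | h
      · exact h
      · exact (hav z hzS _ a0 (h ▸ hz)).elim
      · exact (hav z hzS _ a2 (h ▸ hz)).elim
      · exact (hav z hzS _ a3 (h ▸ hz)).elim
    have h4 := card_union_le {w ∈ S | c w = j} {w ∈ S | c w = j + 2}
    omega

/-! ### Bicliques from a five-colouring -/

/-- Pairs of colours among `0, 1, 2` that are adjacent in the five-cycle. -/
def IsConflict (i k : ZMod 5) : Prop :=
  (i = 0 ∧ k = 1) ∨ (i = 1 ∧ k = 0) ∨ (i = 1 ∧ k = 2) ∨ (i = 2 ∧ k = 1)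

instance (i k : ZMod 5) : Decidable (IsConflict i k) := by unfold IsConflict; infer_instance

/-- The colour not adjacent to either colour of a conflict. -/
def middleColor (i k : ZMod 5) : ZMod 5 := if i = 0 ∨ k = 0 then 3 else 4

/-- Each conflicting colour pair gets its own Latin rectangle of middle vertices. Conflicts sharing
one colour in the same position have different middle colours, so rectangles do not clash. -/
theorem isBicliqueIn_of_hom_five_cycle [DecidableEq V] {c : V → ZMod 5}
    (hc : ∀ w ∈ S, ∀ z ∈ S, H.Adj w z → c z = c w + 1 ∨ c z = c w + 4) {A B : Finset V}
    (hA : A ⊆ S) (hB : B ⊆ S) (hAB : Disjoint A B) (cA : ∀ x ∈ A, c x = 0 ∨ c x = 1 ∨ c x = 2)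
    (cB : ∀ x ∈ B, c x = 0 ∨ c x = 1 ∨ c x = 2)
    (hAc : ∀ i k, IsConflict i k → #{x ∈ A | c x = i} ≤ #{x ∈ S | c x = middleColor i k})
    (hBc : ∀ i k, IsConflict i k → #{x ∈ B | c x = k} ≤ #{x ∈ S | c x = middleColor i k}) :
    ∃ E, IsBicliqueIn H S A B E := by
  have hg : ∀ i k, ∃ g : V → V → V, IsConflict i k →
      (∀ x ∈ A, c x = i → ∀ y ∈ B, c y = k → g x y ∈ S ∧ c (g x y) = middleColor i k) ∧
      (∀ x ∈ A, c x = i → ∀ y ∈ B, c y = k → ∀ y' ∈ B, c y' = k → g x y = g x y' → y = y') ∧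
      ∀ x ∈ A, c x = i → ∀ x' ∈ A, c x' = i → ∀ y ∈ B, c y = k → g x y = g x' y → x = x' := by
    intro i k
    by_cases h : IsConflict i k
    · obtain ⟨g, h1, h2, h3⟩ := exists_latin_rectangle (hAc i k h) (hBc i k h)
      refine ⟨g, fun _ => ⟨?_, ?_, ?_⟩⟩
      · intro x hx hxi y hy hyk
        exact mem_filter.1 (h1 x (mem_filter.2 ⟨hx, hxi⟩) y (mem_filter.2 ⟨hy, hyk⟩))
      · intro x hx hxi y hy hyk y' hy' hyk'
        exact h2 x (mem_filter.2 ⟨hx, hxi⟩) y (mem_filter.2 ⟨hy, hyk⟩) y' (mem_filter.2 ⟨hy', hyk'⟩)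
      · intro x hx hxi x' hx' hxi' y hy hyk
        exact h3 x (mem_filter.2 ⟨hx, hxi⟩) x' (mem_filter.2 ⟨hx', hxi'⟩) y (mem_filter.2 ⟨hy, hyk⟩)
    · exact ⟨fun x _ => x, fun h' => (h h').elim⟩
  choose g hg using hg
  have hconf : ∀ x ∈ A, ∀ y ∈ B, H.Adj x y → IsConflict (c x) (c y) := by
    intro x hx y hy hxy
    have key : ∀ i k : ZMod 5, (i = 0 ∨ i = 1 ∨ i = 2) → (k = 0 ∨ k = 1 ∨ k = 2) →
      (k = i + 1 ∨ k = i + 4) → IsConflict i k := by decide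
    exact key _ _ (cA x hx) (cB y hy) (hc x (hA hx) y (hB hy) hxy)
  have hmid : ∀ i k, ¬ (middleColor i k = 0 ∨ middleColor i k = 1 ∨ middleColor i k = 2) := by
    decide
  refine isBicliqueIn_of_middle hA hB hAB (fun x y => g (c x) (c y) x y) ?_ ?_ ?_
  · intro x hx y hy hxy
    have hcf := hconf x hx y hy hxy
    obtain ⟨hzS, hz⟩ := (hg _ _ hcf).1 x hx rfl y hy rfl
    refine ⟨hzS, fun h => hmid _ _ (hz ▸ cA _ h), fun h => hmid _ _ (hz ▸ cB _ h),
      fun h => ?_, fun h => ?_⟩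
    · have h1 := hc _ (hA hx) _ hzS h
      rw [hz] at h1
      have key : ∀ i k, IsConflict i k →
        ¬ (middleColor i k = i + 1 ∨ middleColor i k = i + 4) := by decide
      exact key _ _ hcf h1
    · have h1 := hc _ hzS _ (hB hy) h
      rw [hz] at h1
      have key : ∀ i k, IsConflict i k →
        ¬ (k = middleColor i k + 1 ∨ k = middleColor i k + 4) := by decide
      exact key _ _ hcf h1
  · intro x hx y hy y' hy' hxy hxy' hf
    have h1 := hconf x hx y hy hxy
    have h2 := hconf x hx y' hy' hxy'
    have k1 := ((hg _ _ h1).1 x hx rfl y hy rfl).2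
    have k2 := ((hg _ _ h2).1 x hx rfl y' hy' rfl).2
    have key : ∀ i k k', IsConflict i k → IsConflict i k' →
      middleColor i k = middleColor i k' → k' = k := by decide
    have e := key _ _ _ h1 h2 (k1.symm.trans (hf ▸ k2))
    rw [e] at hf
    exact (hg _ _ h1).2.1 x hx rfl y hy rfl y' hy' e hf
  · intro x hx x' hx' y hy hxy hxy' hf
    have h1 := hconf x hx y hy hxy
    have h2 := hconf x' hx' y hy hxy'
    have k1 := ((hg _ _ h1).1 x hx rfl y hy rfl).2
    have k2 := ((hg _ _ h2).1 x' hx' rfl y hy rfl).2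
    have key : ∀ i i' k, IsConflict i k → IsConflict i' k →
      middleColor i k = middleColor i' k → i' = i := by decide
    have e := key _ _ _ h1 h2 (k1.symm.trans (hf ▸ k2))
    rw [e] at hf
    exact (hg _ _ h1).2.2 x hx rfl x' hx' e y hy rfl hf

open Classical in
theorem hasBicliqueIn_of_hom_five_cycle {m l : ℕ} (hS : #S + 1 = 2 * m) (hl : 2 * l ≤ m)
    (hmax : ∀ I ⊆ S, (∀ x ∈ I, ∀ y ∈ I, ¬ H.Adj x y) → #I < m) {c : V → ZMod 5}
    (hc : ∀ w ∈ S, ∀ z ∈ S, H.Adj w z → c z = c w + 1 ∨ c z = c w + 4)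
    (hsmall : ∀ j, #{w ∈ S | c w = j} < l)
    (hbig : ∀ j, m < #{w ∈ S | c w = j} + #{w ∈ S | c w = j + 2} + l)
    (hmin : ∀ j, #{w ∈ S | c w = 1} ≤ #{w ∈ S | c w = j}) : HasBicliqueIn H S l (m - l) := by
  let W : ZMod 5 → Finset V := fun j => {w ∈ S | c w = j}
  have hW : ∀ j x, x ∈ W j ↔ x ∈ S ∧ c x = j := fun j x => by simp [W]
  have hWS : ∀ j, W j ⊆ S := fun j => filter_subset _ _
  have hdisj : ∀ i j, i ≠ j → Disjoint (W i) (W j) := fun i j hij => by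
    rw [Finset.disjoint_left]
    intro x hx hx'
    exact hij (((hW i x).1 hx).2.symm.trans ((hW j x).1 hx').2)
  have hsum : #S = #(W 0) + #(W 1) + #(W 2) + #(W 3) + #(W 4) := by
    rw [card_eq_sum_card_fiberwise (f := c) (t := univ) (by simp)]
    exact Fin.sum_univ_five (fun j : Fin 5 => #(W j))
  have h02 : #(W 0) + #(W 2) < m := by
    rw [← card_union_of_disjoint (hdisj 0 2 (by decide))]
    refine hmax _ (union_subset (hWS 0) (hWS 2)) ?_
    intro x hx y hy hxy
    simp only [mem_union, hW] at hx hy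
    have := hc x (by tauto) y (by tauto) hxy
    rcases hx with ⟨-, hx⟩ | ⟨-, hx⟩ <;> rcases hy with ⟨-, hy⟩ | ⟨-, hy⟩ <;>
      rw [hx, hy] at this <;> revert this <;> decide
  obtain ⟨a0, a1, a2, x1, n1, n2, n3, n4, n5, n6, n7, n8, n9, n10⟩ : ∃ a0 a1 a2 x1 : ℕ,
      a0 ≤ #(W 0) ∧ a0 ≤ #(W 3) ∧ #(W 0) - a0 ≤ #(W 3) ∧ a2 ≤ #(W 2) ∧ a2 ≤ #(W 4) ∧
      #(W 2) - a2 ≤ #(W 4) ∧ x1 ≤ #(W 1) ∧ a1 ≤ x1 ∧ a0 + a1 + a2 = l ∧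
      #(W 0) + x1 + #(W 2) = m := by
    have s0 := hsmall 0
    have s1 := hsmall 1
    have s2 := hsmall 2
    have s3 := hsmall 3
    have s4 := hsmall 4
    have b1 : m < #(W 1) + #(W 3) + l := hbig 1
    have b4 : m < #(W 4) + #(W 1) + l := hbig 4
    have m3 := hmin 3
    have m4 := hmin 4
    change #(W _) < _ at s0 s1 s2 s3 s4
    change #(W _) ≤ #(W _) at m3 m4
    generalize #(W 0) = p0 at *
    generalize #(W 1) = p1 at *
    generalize #(W 2) = p2 at *
    generalize #(W 3) = p3 at *
    generalize #(W 4) = p4 at *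
    clear hmax hc hsmall hbig hmin hdisj hW hWS
    -- Take as much of class `0` as fits in class `3`, reserving the `p2 - p4` vertices (truncated)
    -- that `A` must take from class `2` so that the rest fits in class `4`. Minimality of class `1`
    -- and `hbig` give `2 * p3 > m - l ≥ l > p0`, and likewise `2 * p4 > p2`.
    obtain ⟨a0, ha0⟩ : ∃ a0, a0 = min (min p0 p3) (l - (p2 - p4)) := ⟨_, rfl⟩
    obtain ⟨a2, ha2⟩ : ∃ a2, a2 = min (min p2 p4) (l - a0) := ⟨_, rfl⟩
    refine ⟨a0, l - a0 - a2, a2, m - p0 - p2, ?_⟩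
    omega
  have m13 : #(W 1) ≤ #(W 3) := hmin 3
  have m14 : #(W 1) ≤ #(W 4) := hmin 4
  obtain ⟨A0, hA0, hA0c⟩ := exists_subset_card_eq n1
  obtain ⟨A2, hA2, hA2c⟩ := exists_subset_card_eq n4
  obtain ⟨X, hX, hXc⟩ := exists_subset_card_eq n7
  obtain ⟨A1, hA1, hA1c⟩ := exists_subset_card_eq (hXc.symm ▸ n8)
  have dis : ∀ {P Q : Finset V} {i j : ZMod 5}, P ⊆ W i → Q ⊆ W j → i ≠ j → Disjoint P Q :=
    fun hP hQ hij => disjoint_of_subset_left hP (disjoint_of_subset_right hQ (hdisj _ _ hij))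
  let A := A0 ∪ A1 ∪ A2
  let U := W 0 ∪ X ∪ W 2
  have hU : #U = m := by
    rw [card_union_of_disjoint, card_union_of_disjoint, hXc, n10]
    · exact dis subset_rfl hX (by decide)
    · rw [disjoint_union_left]
      exact ⟨hdisj _ _ (by decide), dis hX subset_rfl (by decide)⟩
  have hA : #A = l := by
    rw [card_union_of_disjoint, card_union_of_disjoint, hA0c, hA1c, hA2c, n9]
    · exact dis hA0 (hA1.trans hX) (by decide)
    · rw [disjoint_union_left]
      exact ⟨dis hA0 hA2 (by decide), dis (hA1.trans hX) hA2 (by decide)⟩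
  have hAU : A ⊆ U := union_subset_union (union_subset_union hA0 hA1) hA2
  have hU' : ∀ x ∈ U, x ∈ S ∧ ((c x = 0 ∧ x ∈ W 0) ∨ (c x = 1 ∧ x ∈ X) ∨ (c x = 2 ∧ x ∈ W 2)) := by
    intro x hx
    simp only [U, mem_union] at hx
    rcases hx with (hx | hx) | hx
    · have := (hW _ _).1 hx; tauto
    · have := (hW _ _).1 (hX hx); tauto
    · have := (hW _ _).1 hx; tauto
  have fA0 : #{x ∈ A | c x = 0} ≤ a0 := hA0c ▸ card_le_card fun x hx => by
    obtain ⟨hx, h0⟩ := mem_filter.1 hx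
    simp only [A, mem_union] at hx
    rcases hx with (hx | hx) | hx
    · exact hx
    · have := ((hW _ _).1 (hX (hA1 hx))).2; exact absurd (h0.symm.trans this) (by decide)
    · have := ((hW _ _).1 (hA2 hx)).2; exact absurd (h0.symm.trans this) (by decide)
  have fA2 : #{x ∈ A | c x = 2} ≤ a2 := hA2c ▸ card_le_card fun x hx => by
    obtain ⟨hx, h0⟩ := mem_filter.1 hx
    simp only [A, mem_union] at hx
    rcases hx with (hx | hx) | hx
    · have := ((hW _ _).1 (hA0 hx)).2; exact absurd (h0.symm.trans this) (by decide)
    · have := ((hW _ _).1 (hX (hA1 hx))).2; exact absurd (h0.symm.trans this) (by decide)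
    · exact hx
  have f1 : ∀ P ⊆ U, #{x ∈ P | c x = 1} ≤ #(W 1) := fun P hP => card_le_card fun x hx => by
    obtain ⟨hx, h0⟩ := mem_filter.1 hx
    exact (hW _ _).2 ⟨(hU' x (hP hx)).1, h0⟩
  have fB0 : #{x ∈ U \ A | c x = 0} ≤ #(W 0) - a0 := by
    rw [← hA0c, ← card_sdiff_of_subset hA0]
    refine card_le_card fun x hx => ?_
    simp only [mem_filter, mem_sdiff, A, mem_union] at hx ⊢
    exact ⟨(hW _ _).2 ⟨(hU' x hx.1.1).1, hx.2⟩, by tauto⟩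
  have fB2 : #{x ∈ U \ A | c x = 2} ≤ #(W 2) - a2 := by
    rw [← hA2c, ← card_sdiff_of_subset hA2]
    refine card_le_card fun x hx => ?_
    simp only [mem_filter, mem_sdiff, A, mem_union] at hx ⊢
    exact ⟨(hW _ _).2 ⟨(hU' x hx.1.1).1, hx.2⟩, by tauto⟩
  have fA1 := f1 A hAU
  have fB1 := f1 (U \ A) sdiff_subset
  have hBU : ∀ y ∈ U \ A, y ∈ U := fun y hy => (mem_sdiff.1 hy).1
  have hcU : ∀ x ∈ U, c x = 0 ∨ c x = 1 ∨ c x = 2 := fun x hx => by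
    have := (hU' x hx).2
    tauto
  obtain ⟨E, hE⟩ := isBicliqueIn_of_hom_five_cycle hc (A := A) (B := U \ A)
    (fun x hx => (hU' x (hAU hx)).1) (fun x hx => (hU' x (hBU x hx)).1) disjoint_sdiff
    (fun x hx => hcU x (hAU hx)) (fun x hx => hcU x (hBU x hx))
    (by rintro i k (⟨rfl, rfl⟩ | ⟨rfl, rfl⟩ | ⟨rfl, rfl⟩ | ⟨rfl, rfl⟩) <;>
          first | (change _ ≤ #(W 3); omega) | (change _ ≤ #(W 4); omega))
    (by rintro i k (⟨rfl, rfl⟩ | ⟨rfl, rfl⟩ | ⟨rfl, rfl⟩ | ⟨rfl, rfl⟩) <;>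
          first | (change _ ≤ #(W 3); omega) | (change _ ≤ #(W 4); omega))
  exact ⟨A, U \ A, E, hE, hA, by rw [card_sdiff_of_subset hAU, hU, hA]⟩

/-! ### The dense case, the induction and the theorem -/

theorem hasBicliqueIn_of_dense (htf : ∀ a b c, H.Adj a b → H.Adj b c → ¬ H.Adj a c) {m l : ℕ}
    (hS : #S + 1 = 2 * m) (hl : 2 * l ≤ m) (hiso : ∀ u ∈ S, ∃ v ∈ S, H.Adj u v)
    (hdeg : ∀ u ∈ S, ∀ v ∈ S, H.Adj u v → 2 * m ≤ #(H.nbrsIn S u) + #(H.nbrsIn S v) + l) :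
    HasBicliqueIn H S l (m - l) := by
  classical
  by_cases hmax : ∀ I ⊆ S, (∀ x ∈ I, ∀ y ∈ I, ¬ H.Adj x y) → #I < m
  · obtain ⟨v, hvS, hv⟩ := exists_five_cycle htf hS hl hiso hdeg hmax
    obtain ⟨c, hc, hsmall, hbig⟩ := exists_hom_five_cycle htf hS hl hdeg hmax hvS hv
    obtain ⟨j, -, hj⟩ := exists_min_image univ (fun j => #{w ∈ S | c w = j}) ⟨0, mem_univ _⟩
    have hsh : ∀ k w, c w - j + 1 = k ↔ c w = k + j - 1 := fun k w => by
      constructor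
      · rintro rfl; ring
      · intro h; rw [h]; ring
    -- Rotate the colours so that a smallest class receives colour `1`.
    refine hasBicliqueIn_of_hom_five_cycle hS hl hmax (c := fun w => c w - j + 1) ?_ ?_ ?_ ?_
    · intro w hw z hz hwz
      rcases hc w hw z hz hwz with h | h
      · left; rw [h]; ring
      · right; rw [h]; ring
    · intro k
      simp only [hsh]
      exact hsmall (k + j - 1)
    · intro k
      simp only [hsh]
      have := hbig (k + j - 1)
      rwa [show k + j - 1 + 2 = k + 2 + j - 1 by ring] at this
    · intro k
      simp only [hsh]
      rw [show 1 + j - 1 = j by ring]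
      exact hj (k + j - 1) (mem_univ _)
  · push Not at hmax
    obtain ⟨I, hI, hind, hc⟩ := hmax
    exact hasBicliqueIn_of_indep hI hc (by omega) hind

theorem hasBicliqueIn_of_card (htf : ∀ a b c, H.Adj a b → H.Adj b c → ¬ H.Adj a c) {m l : ℕ}
    (hS : #S + 1 = 2 * m) (hl : 2 * l ≤ m) : HasBicliqueIn H S l (m - l) := by
  classical
  induction m generalizing S l with
  | zero => omega
  | succ m ih =>
    -- The value `l = 0` is needed because the recursion below may lower `l`.
    rcases Nat.eq_zero_or_pos l with rfl | hl0
    · obtain ⟨B, hB, hBc⟩ := exists_subset_card_eq (show m + 1 ≤ #S by omega)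
      obtain ⟨E, hE⟩ := isBicliqueIn_of_middle (H := H) (empty_subset S) hB (disjoint_empty_left B)
        (fun x _ => x) (by simp) (by simp) (by simp)
      exact ⟨∅, B, E, hE, rfl, hBc⟩
    have hrec : ∀ u ∈ S, ∀ v ∈ S, u ≠ v → HasBicliqueIn H ((S.erase u).erase v) l (m - l) := by
      intro u hu v hv huv
      have hcard : #((S.erase u).erase v) + 1 = 2 * m := by
        rw [card_erase_of_mem (mem_erase.2 ⟨huv.symm, hv⟩), card_erase_of_mem hu]
        omega
      by_cases h : 2 * l ≤ m
      · exact ih hcard h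
      -- Here `m + 1 = 2 * l`, so the sides `l` and `m - l = l - 1` are exchanged.
      · have := (ih (l := l - 1) hcard (by omega)).symm
        rwa [show m - (l - 1) = l by omega, show l - 1 = m - l by omega] at this
    rw [show m + 1 - l = m - l + 1 by omega]
    by_cases hiso : ∀ u ∈ S, ∃ v ∈ S, H.Adj u v
    · by_cases hdeg : ∀ u ∈ S, ∀ v ∈ S, H.Adj u v →
          2 * (m + 1) ≤ #(H.nbrsIn S u) + #(H.nbrsIn S v) + l
      · have := hasBicliqueIn_of_dense htf hS hl hiso hdeg
        rwa [show m + 1 - l = m - l + 1 by omega] at this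
      · push Not at hdeg
        obtain ⟨u, hu, v, hv, huv, hd⟩ := hdeg
        exact (hrec u hu v hv huv.ne).succ_right_of_edge htf hu hv huv (by omega)
    · push Not at hiso
      obtain ⟨u, hu, hiso⟩ := hiso
      obtain ⟨v, hv⟩ : (S.erase u).Nonempty := card_pos.1 (by rw [card_erase_of_mem hu]; omega)
      obtain ⟨hvu, hv⟩ := mem_erase.1 hv
      exact (hrec u hu v hv hvu.symm).succ_right_of_isolated hu hv hvu.symm hiso

end

theorem mainTheorem1 {V : Type*} [Fintype V] (G : SimpleGraph V) (n : ℕ)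
    (hn : Fintype.card V = n) (hα : G.indepNum = 2) (l : ℕ) (hl : 0 < l)
    (hln : 2 * l ≤ ⌈(n : ℚ) / 2⌉₊) :
    G.ContainsImmersion (completeBipartiteGraph (Fin l) (Fin (⌈(n : ℚ) / 2⌉₊ - l))) := by
  classical
  have hceil : ⌈(n : ℚ) / 2⌉₊ = (n + 1) / 2 := by
    apply le_antisymm
    · rw [Nat.ceil_le, div_le_iff₀ (by norm_num)]
      exact_mod_cast (by omega : n ≤ (n + 1) / 2 * 2)
    · have h := Nat.le_ceil ((n : ℚ) / 2)
      rw [div_le_iff₀ (by norm_num)] at h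
      have h' : n ≤ ⌈(n : ℚ) / 2⌉₊ * 2 := by exact_mod_cast h
      omega
  rw [hceil] at hln ⊢
  have htf : ∀ a b c, Gᶜ.Adj a b → Gᶜ.Adj b c → ¬ Gᶜ.Adj a c := by
    intro a b c hab hbc hac
    have hind : G.IsIndepSet (({a, b, c} : Finset V) : Set V) := by
      intro x hx y hy hxy h
      simp only [SimpleGraph.compl_adj] at hab hbc hac
      simp at hx hy
      rcases hx with rfl | rfl | rfl <;> rcases hy with rfl | rfl | rfl <;>
        simp_all [SimpleGraph.adj_comm]
    have := hind.card_le_indepNum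
    rw [hα, card_eq_three.2 ⟨a, b, c, hab.ne, hac.ne, hbc.ne, rfl⟩] at this
    omega
  -- For even `n` one vertex is discarded to make the size odd.
  obtain ⟨S, -, hS⟩ := exists_subset_card_eq (s := (univ : Finset V)) (n := 2 * ((n + 1) / 2) - 1)
    (by rw [card_univ, hn]; omega)
  exact (hasBicliqueIn_of_card (S := S) htf (by omega) hln).containsImmersion
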